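/- Let $\alpha>0$ and let $f:\mathbb R^d\to\mathbb R$ be differentiable and $\alpha$-strongly convex, i.e. $f(y)\ge f(x)+\langle\nabla f(x),y-x\rangle+\frac{\alpha}{2}\|y-x\|^2$ for all $x,y\in\mathbb R^d$ (Euclidean norm), and let $x^*$ be a minimizer of $f$. Let $(X_t,Y_t)_{t\ge 0}$, with values in $\mathbb R^d\times\mathbb R^d$, follow the randomized Hamiltonian flow with the constant rate $\gamma=\sqrt{16\alpha/5}$, that is: on a probability space with a filtration $(\mathcal F_t)_{t\ge0}$, let $0<T_1<T_2<\cdots$ be the event times of a Poisson process $N_t=\#\{k:T_k\le t\}$ of rate $\gamma$ relative to $(\mathcal F_t)$ ($N$ is adapted and, for $0\le s\le t$, $N_t-N_s$ is independent of $\mathcal F_s$ and Poisson distributed with mean $\gamma(t-s)$), and let $(X_t,Y_t)$ be $(\mathcal F_t)$-adapted, with $Y$ right-continuous with left limits, and satisfy almost surely, for all $t\ge0$, $$X_t=X_0+\int_0^tY_s\,ds,\qquad Y_t=Y_0-\int_0^t\nabla f(X_s)\,ds-\sum_{k:\,T_k\le t}Y_{T_k^-},$$ i.e. $dX_t=Y_t\,dt$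 and $dY_t=-\nabla f(X_t)\,dt-Y_{t^-}\,dN_t$, so that the velocity is reset to $0$ at each event time. Suppose $Y_0=0$; the initial position $X_0$ is arbitrary (deterministic, or random and $\mathcal F_0$-measurable). Then for every $t\ge 0$, $$\mathbb E\big[f(X_t)-f(x^*)\big]\le\exp\!\Big(-\sqrt{\tfrac{\alpha}{5}}\,t\Big)\,\mathbb E\Big[f(X_0)-f(x^*)+\frac{\alpha}{10}\|X_0-x^*\|^2\Big],$$ where the expectations of these nonnegative random variables are taken in $[0,\infty]$; if $\mathbb E|f(X_0)|<\infty$, both sides are finite. -/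

import Mathlib

open MeasureTheory ProbabilityTheory Filter Topology
open scoped ENNReal Gradient RealInnerProductSpace

/-- A differentiable function `f : ℝᵈ → ℝ` is `α`-strongly convex if
`f y ≥ f x + ⟪∇f x, y - x⟫ + (α / 2) ‖y - x‖²` for all `x, y`. -/
structure IsStronglyConvex {d : ℕ} (α : ℝ) (f : EuclideanSpace ℝ (Fin d) → ℝ) : Prop where
  differentiable : Differentiable ℝ f
  le_apply : ∀ x y, f x + ⟪∇ f x, y - x⟫ + α / 2 * ‖y - x‖ ^ 2 ≤ f y

/-- The number `N_t` of events up to and including time `t`, where the `k`-th event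
(`k = 0, 1, 2, …`) happens at time `T k`. -/
noncomputable def eventCount {Ω : Type*} (T : ℕ → Ω → ℝ) (t : ℝ) (ω : Ω) : ℕ :=
  {k : ℕ | T k ω ≤ t}.ncard

/-- `T 0 < T 1 < …` are the event times in `(0, ∞)` of a Poisson process with rate function `γ`
relative to the filtration `ℱ`: the counting process `N` is adapted, and each increment
`N_t - N_s` is independent of `ℱ_s` and Poisson distributed with mean `∫ u in s..t, γ u`.
(Time is a real number, but only times `t ≥ 0` matter.) -/
structure IsPoissonProcess {Ω : Type*} {mΩ : MeasurableSpace Ω} (P : Measure Ω)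
    (ℱ : Filtration ℝ mΩ) (γ : ℝ → ℝ) (T : ℕ → Ω → ℝ) : Prop where
  pos : ∀ᵐ ω ∂P, 0 < T 0 ω
  strictMono : ∀ᵐ ω ∂P, StrictMono fun k => T k ω
  tendsto_atTop : ∀ᵐ ω ∂P, Tendsto (fun k => T k ω) atTop atTop
  adapted : ∀ t, 0 ≤ t → Measurable[ℱ t] (eventCount T t)
  map_increment : ∀ s t, 0 ≤ s → s ≤ t →
    P.map (fun ω => eventCount T t ω - eventCount T s ω)
      = poissonMeasure (∫ u in s..t, γ u).toNNReal
  indep_increment : ∀ s t, 0 ≤ s → s ≤ t →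
    Indep (MeasurableSpace.comap (fun ω => eventCount T t ω - eventCount T s ω) ⊤) (ℱ s) P

/-- `(x, y) : [0, ∞) → ℝᵈ × ℝᵈ` is a path of Hamiltonian dynamics for `f` with velocity refreshment
at the times `τ 0 < τ 1 < …`, that is, a solution of
`dx_t = y_t dt`, `dy_t = -∇f(x_t) dt - y_{t-} dN_t`, `dN = ∑ₖ δ_{τ k}`, in integrated form.
The integral `∫_{(0,t]} y_{s-} dN_s` is the sum of the left limits of `y` at the event times in
`(0, t]`; it is a finite sum since `τ k → ∞` for the event times that are used. -/
structure IsRefreshedHamiltonianPath {d : ℕ} (f : EuclideanSpace ℝ (Fin d) → ℝ) (τ : ℕ → ℝ)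
    (x y : ℝ → EuclideanSpace ℝ (Fin d)) : Prop where
  right_continuous : ∀ t, 0 ≤ t → ContinuousWithinAt y (Set.Ici t) t
  left_limit : ∀ t, 0 < t → ∃ l, Tendsto y (𝓝[<] t) (𝓝 l)
  integrable_gradient : ∀ t, 0 ≤ t → IntervalIntegrable (fun s => ∇ f (x s)) volume 0 t
  position_eq : ∀ t, 0 ≤ t → x t = x 0 + ∫ s in (0 : ℝ)..t, y s
  velocity_eq : ∀ t, 0 ≤ t →
    y t = y 0 - (∫ s in (0 : ℝ)..t, ∇ f (x s))
      - ∑ᶠ k ∈ {k : ℕ | τ k ≤ t}, Function.leftLim y (τ k)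

/-- `(X, Y)` is a randomized Hamiltonian flow for `f` with refreshment rate `γ`: for a Poisson
process with rate `γ` and event times `T` relative to the filtration `ℱ`, the process `(X, Y)` is
adapted to `ℱ` and almost every path solves
`dX_t = Y_t dt`, `dY_t = -∇f(X_t) dt - Y_{t-} dN_t`.
The initial value `(X 0, Y 0)` may be random; being `ℱ 0`-measurable, it is independent of the
Poisson process. -/
structure IsRandomizedHamiltonianFlow {d : ℕ} {Ω : Type*} {mΩ : MeasurableSpace Ω} (P : Measure Ω)
    (ℱ : Filtration ℝ mΩ) (f : EuclideanSpace ℝ (Fin d) → ℝ) (γ : ℝ → ℝ) (T : ℕ → Ω → ℝ)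
    (X Y : ℝ → Ω → EuclideanSpace ℝ (Fin d)) : Prop where
  poisson : IsPoissonProcess P ℱ γ T
  adapted_position : ∀ t, 0 ≤ t → Measurable[ℱ t] (X t)
  adapted_velocity : ∀ t, 0 ≤ t → Measurable[ℱ t] (Y t)
  path : ∀ᵐ ω ∂P, IsRefreshedHamiltonianPath f (fun k => T k ω) (fun t => X t ω) (fun t => Y t ω)

/-! Put `l = √(α/5)`, so that `α = 5 l²` and the refreshment rate is `4 l`. With `z = x - x*`, the
Lyapunov function `V = f x - f x* + ‖y + l z‖² / 2` dominates `f x - f x*`, and for `y = 0` it is `f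
x - f x* + α/10 ‖z‖²`. Along the Hamiltonian flow the energy is constant, and strong convexity
bounds the derivative of the remaining terms of `V` by `lyapunovDrift`. Adding `4 l` times the
change of `V` under `y ↦ 0` gives at most `-l V`, the defect being a perfect square
(`lyapunovDrift_add_jump_le`). So `E V` decays at rate `l`.

The generator is replaced by one-step estimates. Energy never increases along a path, so on the
event that the initial energy is at most `M` the path stays in a compact set, where all moduli of
continuity are uniform. Over a step of length `u` there are zero, one or more events; independence
of the increment from the past gives `E V(t+u) ≤ (1 - l u) E V(t) + o(u)`, uniformly in `t`
(`exists_integral_lyapunov_step_le`). Iterating gives the exponential (`le_exp_mul_of_step_le`), and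
`M → ∞` removes the truncation (`lintegral_le`). -/

/-! ### Strongly convex functions -/

/-- A differentiable function satisfying the gradient inequality has a continuous gradient. -/
theorem IsStronglyConvex.continuous_gradient {d : ℕ} {α : ℝ}
    {f : EuclideanSpace ℝ (Fin d) → ℝ} (hα : 0 ≤ α) (hf : IsStronglyConvex α f) :
    Continuous (∇ f) := by
  have hc : ∀ x y, f x + ⟪∇ f x, y - x⟫ ≤ f y := fun x y => by
    have := hf.le_apply x y
    have : 0 ≤ α / 2 * ‖y - x‖ ^ 2 := by positivity
    linarith
  rw [continuous_iff_continuousAt]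
  intro x
  rw [ContinuousAt, Metric.tendsto_nhds]
  intro ε hε
  have hg := (hf.differentiable x).hasGradientAt
  rw [hasGradientAt_iff_isLittleO] at hg
  have hb := hg.def (show (0 : ℝ) < ε / 3 by positivity)
  obtain ⟨δ, hδ, hball⟩ := Metric.eventually_nhds_iff.1 hb
  filter_upwards [Metric.ball_mem_nhds x (show (0 : ℝ) < δ / 2 by positivity)] with z hz
  rw [Metric.mem_ball, dist_eq_norm] at hz
  rw [dist_eq_norm]
  set w := ∇ f z - ∇ f x with hw
  by_cases hw0 : ‖w‖ = 0
  · rw [hw0]; exact hε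
  have hwpos : 0 < ‖w‖ := lt_of_le_of_ne (norm_nonneg _) (Ne.symm hw0)
  -- A test increment in the direction of the gradient gap `w`. Convexity at `z` and at `x`, against
  -- the first-order expansion at `x`, bounds `⟪w, v⟫` by `ε / 3 * ‖z + v - x‖ ≤ ε / 3 * δ`, hence
  -- `‖w‖ ≤ 2 * ε / 3`.
  set v := (δ / 2 / ‖w‖) • w with hv
  have hvn : ‖v‖ = δ / 2 := by
    rw [hv, norm_smul, Real.norm_of_nonneg (by positivity)]
    field_simp
  have hvw : ⟪w, v⟫ = δ / 2 * ‖w‖ := by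
    rw [hv, inner_smul_right, real_inner_self_eq_norm_sq]
    field_simp
  have hn : ‖z + v - x‖ ≤ ‖z - x‖ + δ / 2 := by
    calc ‖z + v - x‖ = ‖(z - x) + v‖ := by congr 1; abel
      _ ≤ _ := (norm_add_le _ _).trans (by rw [hvn])
  have h1 := hball (y := z + v) (by rw [dist_eq_norm]; linarith)
  have h2 := hc z (z + v)
  have h3 := hc x z
  rw [add_sub_cancel_left] at h2
  rw [Real.norm_eq_abs] at h1
  have h4 := (abs_le.1 h1).2
  have h5 : ⟪∇ f x, z + v - x⟫ = ⟪∇ f x, z - x⟫ + ⟪∇ f x, v⟫ := by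
    rw [← inner_add_right]; congr 1; abel
  have h6 : ⟪w, v⟫ = ⟪∇ f z, v⟫ - ⟪∇ f x, v⟫ := by rw [hw, inner_sub_left]
  have h7 : ε / 3 * ‖z + v - x‖ ≤ ε / 3 * (δ / 2 + δ / 2) := by gcongr; linarith
  have h8 : δ / 2 * ‖w‖ ≤ δ / 2 * (2 * ε / 3) := by linarith
  have h9 := le_of_mul_le_mul_left h8 (by positivity)
  linarith

theorem IsStronglyConvex.sq_norm_le {d : ℕ} {α : ℝ} {f : EuclideanSpace ℝ (Fin d) → ℝ}
    (hf : IsStronglyConvex α f) {xs : EuclideanSpace ℝ (Fin d)} (hxs : ∀ x, f xs ≤ f x)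
    (x : EuclideanSpace ℝ (Fin d)) : α / 2 * ‖x - xs‖ ^ 2 ≤ f x - f xs := by
  have h0 : ∇ f xs = 0 := by
    have : IsLocalMin f xs := Eventually.of_forall hxs
    rw [gradient, this.fderiv_eq_zero, map_zero]
  have := hf.le_apply xs x
  rw [h0, inner_zero_left] at this
  linarith

/-! ### Energy and Lyapunov function -/

/-- The energy, normalised to vanish at the minimizer `xs` at rest. -/
noncomputable def energy {d : ℕ} (f : EuclideanSpace ℝ (Fin d) → ℝ)
    (xs : EuclideanSpace ℝ (Fin d)) (p : EuclideanSpace ℝ (Fin d) × EuclideanSpace ℝ (Fin d)) : ℝ :=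
  f p.1 - f xs + ‖p.2‖ ^ 2 / 2

/-- The Lyapunov function `f x - f xs + ‖y + l (x - xs)‖² / 2`. -/
noncomputable def lyapunov {d : ℕ} (f : EuclideanSpace ℝ (Fin d) → ℝ)
    (xs : EuclideanSpace ℝ (Fin d)) (l : ℝ)
    (p : EuclideanSpace ℝ (Fin d) × EuclideanSpace ℝ (Fin d)) : ℝ :=
  f p.1 - f xs + ‖p.2 + l • (p.1 - xs)‖ ^ 2 / 2

/-- An upper bound for the derivative of the Lyapunov function along the Hamiltonian flow of a
`5 l²`-strongly convex function. -/
noncomputable def lyapunovDrift {d : ℕ} (f : EuclideanSpace ℝ (Fin d) → ℝ)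
    (xs : EuclideanSpace ℝ (Fin d)) (l : ℝ)
    (p : EuclideanSpace ℝ (Fin d) × EuclideanSpace ℝ (Fin d)) : ℝ :=
  l * ‖p.2‖ ^ 2 - l * (f p.1 - f xs + 5 * l ^ 2 / 2 * ‖p.1 - xs‖ ^ 2) + l ^ 2 * ⟪p.2, p.1 - xs⟫

section

variable {d : ℕ} {f : EuclideanSpace ℝ (Fin d) → ℝ} {xs : EuclideanSpace ℝ (Fin d)} {l : ℝ}

theorem lyapunov_eq (p : EuclideanSpace ℝ (Fin d) × EuclideanSpace ℝ (Fin d)) :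
    lyapunov f xs l p
      = energy f xs p + l * ⟪p.2, p.1 - xs⟫ + l ^ 2 / 2 * ‖p.1 - xs‖ ^ 2 := by
  rw [lyapunov, energy, norm_add_sq_real, inner_smul_right, norm_smul, mul_pow, Real.norm_eq_abs,
    sq_abs]
  ring

/-- The right side minus the left is exactly `l / 2 * ‖y + 2 l z‖²`, with `z = x - xs`. The
constants 5 in the convexity and 4 in the rate are what complete this square. -/
theorem lyapunovDrift_add_jump_le (hl : 0 ≤ l)
    (p : EuclideanSpace ℝ (Fin d) × EuclideanSpace ℝ (Fin d)) :
    lyapunovDrift f xs l p + 4 * l * (lyapunov f xs l (p.1, 0) - lyapunov f xs l p)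
      ≤ -l * lyapunov f xs l p := by
  have h : 0 ≤ l / 2 * ‖p.2 + (2 * l) • (p.1 - xs)‖ ^ 2 := by positivity
  rw [norm_add_sq_real, inner_smul_right, norm_smul, mul_pow, Real.norm_eq_abs, sq_abs] at h
  simp only [lyapunov_eq, energy, lyapunovDrift, inner_zero_left, norm_zero]
  linarith

theorem le_lyapunov (p : EuclideanSpace ℝ (Fin d) × EuclideanSpace ℝ (Fin d)) :
    f p.1 - f xs ≤ lyapunov f xs l p :=
  le_add_of_nonneg_right (by positivity)

theorem continuous_energy (hf : Continuous f) : Continuous (energy f xs) := by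
  unfold energy; fun_prop

theorem continuous_lyapunov (hf : Continuous f) : Continuous (lyapunov f xs l) := by
  unfold lyapunov; fun_prop

theorem continuous_lyapunovDrift (hf : Continuous f) : Continuous (lyapunovDrift f xs l) := by
  unfold lyapunovDrift; fun_prop

theorem energy_rest_le (x y : EuclideanSpace ℝ (Fin d)) :
    energy f xs (x, 0) ≤ energy f xs (x, y) := by
  simp only [energy, norm_zero]
  have := sq_nonneg ‖y‖
  linarith

/-- Quadratic growth of `f` bounds the position and `f ≥ f xs` bounds the velocity. This is the
source of all uniform constants below. -/
theorem isCompact_energy_le {α : ℝ} (hα : 0 < α) (hf : IsStronglyConvex α f)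
    (hxs : ∀ x, f xs ≤ f x) (M : ℝ) : IsCompact {p | energy f xs p ≤ M} := by
  refine Metric.isCompact_of_isClosed_isBounded
    (isClosed_le (continuous_energy hf.differentiable.continuous) continuous_const) ?_
  have hsub : {p | energy f xs p ≤ M} ⊆
      Metric.closedBall xs √(2 * M / α) ×ˢ Metric.closedBall 0 √(2 * M) := by
    rintro ⟨x, y⟩ hp
    simp only [Set.mem_ofPred_eq, energy] at hp
    have h1 := hf.sq_norm_le hxs x
    have h2 := hxs x
    have h3 := sq_nonneg ‖y‖
    refine ⟨?_, ?_⟩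
    · rw [mem_closedBall_iff_norm]
      apply Real.le_sqrt_of_sq_le
      rw [le_div_iff₀ hα]
      linarith
    · rw [mem_closedBall_iff_norm, sub_zero]
      apply Real.le_sqrt_of_sq_le
      linarith
  exact (Metric.isBounded_closedBall.prod Metric.isBounded_closedBall).subset hsub

/-! ### Hamiltonian flow without refreshment -/

/-- `(x, y)` solves Hamilton's equations for `f` on `[a, b]`. -/
def IsHamiltonianOn {d : ℕ} (f : EuclideanSpace ℝ (Fin d) → ℝ) (a b : ℝ)
    (x y : ℝ → EuclideanSpace ℝ (Fin d)) : Prop :=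
  ∀ u ∈ Set.Icc a b, HasDerivAt x (y u) u ∧ HasDerivAt y (-∇ f (x u)) u

namespace IsHamiltonianOn

variable {a b : ℝ} {x y : ℝ → EuclideanSpace ℝ (Fin d)}

theorem hasDerivAt_apply (h : IsHamiltonianOn f a b x y) (hf : Differentiable ℝ f) {u : ℝ}
    (hu : u ∈ Set.Icc a b) : HasDerivAt (fun u => f (x u)) ⟪∇ f (x u), y u⟫ u :=
  ((hf (x u)).hasGradientAt.hasFDerivAt).comp_hasDerivAt u (h u hu).1

theorem hasDerivAt_energy (h : IsHamiltonianOn f a b x y) (hf : Differentiable ℝ f) {u : ℝ}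
    (hu : u ∈ Set.Icc a b) : HasDerivAt (fun u => energy f xs (x u, y u)) 0 u := by
  have h1 := ((h.hasDerivAt_apply hf hu).sub_const (f xs)).add ((h u hu).2.norm_sq.div_const 2)
  refine h1.congr_deriv ?_
  rw [inner_neg_right, real_inner_comm]
  ring

theorem energy_eq (h : IsHamiltonianOn f a b x y) (hf : Differentiable ℝ f) {u : ℝ}
    (hu : u ∈ Set.Icc a b) : energy f xs (x u, y u) = energy f xs (x a, y a) :=
  constant_of_has_deriv_right_zero
    (fun _ hv => (h.hasDerivAt_energy hf hv).continuousAt.continuousWithinAt)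
    (fun _ hv => (h.hasDerivAt_energy hf (Set.Ico_subset_Icc_self hv)).hasDerivWithinAt) u hu

theorem norm_sub_le (h : IsHamiltonianOn f a b x y) {C : ℝ}
    (hC : ∀ u ∈ Set.Icc a b, ‖y u‖ ≤ C ∧ ‖∇ f (x u)‖ ≤ C) {u : ℝ} (hu : u ∈ Set.Icc a b) :
    ‖x u - x a‖ ≤ C * (u - a) ∧ ‖y u - y a‖ ≤ C * (u - a) := by
  refine ⟨norm_image_sub_le_of_norm_deriv_le_segment'
      (fun v hv => (h v hv).1.hasDerivWithinAt)
      (fun v hv => (hC v (Set.Ico_subset_Icc_self hv)).1) u hu,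
    norm_image_sub_le_of_norm_deriv_le_segment'
      (fun v hv => (h v hv).2.hasDerivWithinAt)
      (fun v hv => ?_) u hu⟩
  rw [norm_neg]
  exact (hC v (Set.Ico_subset_Icc_self hv)).2

/-- The energy part has derivative zero. The cross term produces `-l * ⟪∇ f x, x - xs⟫`, which
strong convexity between `x` and `xs` bounds from above. -/
theorem exists_hasDerivAt_lyapunov (h : IsHamiltonianOn f a b x y) (hl : 0 ≤ l)
    (hf : IsStronglyConvex (5 * l ^ 2) f) {u : ℝ} (hu : u ∈ Set.Icc a b) :
    ∃ D ≤ lyapunovDrift f xs l (x u, y u),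
      HasDerivAt (fun u => lyapunov f xs l (x u, y u)) D u := by
  have hz := (h u hu).1.sub_const xs
  have h1 := ((h.hasDerivAt_energy (xs := xs) hf.differentiable hu).add
    (((h u hu).2.inner ℝ hz).const_mul l)).add (hz.norm_sq.const_mul (l ^ 2 / 2))
  refine ⟨_, ?_, h1.congr_of_eventuallyEq (Eventually.of_forall fun v => lyapunov_eq _)⟩
  have h2 := hf.le_apply (x u) xs
  rw [← neg_sub (x u) xs, inner_neg_right, norm_neg] at h2
  rw [inner_neg_left, real_inner_self_eq_norm_sq, real_inner_comm (y u), lyapunovDrift]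
  nlinarith [mul_le_mul_of_nonneg_left h2 hl]

end IsHamiltonianOn

/-- One step of the flow without refreshment: a Hamiltonian path started at energy at most `M`
changes the Lyapunov function at the rate `lyapunovDrift`, up to `ε`, and moves at most
`C * (b - a)` in position and velocity. -/
theorem exists_step_estimates (hl : 0 < l) (hf : IsStronglyConvex (5 * l ^ 2) f)
    (hxs : ∀ x, f xs ≤ f x) (M : ℝ) :
    ∃ C : ℝ, 0 ≤ C ∧
      (∀ p, energy f xs p ≤ M → |lyapunov f xs l p| ≤ C ∧ |lyapunovDrift f xs l p| ≤ C) ∧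
      (∀ a b x y, IsHamiltonianOn f a b x y → energy f xs (x a, y a) ≤ M →
        ∀ u ∈ Set.Icc a b, ‖x u - x a‖ ≤ C * (u - a) ∧ ‖y u - y a‖ ≤ C * (u - a)) ∧
      ∀ ε > 0, ∃ δ > 0,
        (∀ a b x y, a ≤ b → b - a ≤ δ → IsHamiltonianOn f a b x y → energy f xs (x a, y a) ≤ M →
          lyapunov f xs l (x b, y b) ≤ lyapunov f xs l (x a, y a)
            + (b - a) * (lyapunovDrift f xs l (x a, y a) + ε)) ∧
        ∀ h p q, 0 ≤ h → h ≤ δ → energy f xs p ≤ M → energy f xs q ≤ M →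
          ‖p.1 - q.1‖ ≤ 2 * C * h → ‖p.2 - q.2‖ ≤ 2 * C * h →
          lyapunov f xs l p ≤ lyapunov f xs l q + ε := by
  have hfc := hf.differentiable.continuous
  have hK := isCompact_energy_le (by positivity) hf hxs M
  have hVc : Continuous (lyapunov f xs l) := continuous_lyapunov hfc
  have hDc : Continuous (lyapunovDrift f xs l) := continuous_lyapunovDrift hfc
  obtain ⟨C₁, h₁⟩ := hK.exists_bound_of_continuousOn hVc.continuousOn
  obtain ⟨C₂, h₂⟩ := hK.exists_bound_of_continuousOn hDc.continuousOn
  obtain ⟨C₃, h₃⟩ := hK.exists_bound_of_continuousOn (continuous_snd.continuousOn)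
  obtain ⟨C₄, h₄⟩ := hK.exists_bound_of_continuousOn
    (((hf.continuous_gradient (by positivity)).comp continuous_fst).continuousOn)
  obtain ⟨C, hC0, hC1, hC2, hC3, hC4⟩ :
      ∃ C : ℝ, 0 ≤ C ∧ C₁ ≤ C ∧ C₂ ≤ C ∧ C₃ ≤ C ∧ C₄ ≤ C :=
    ⟨max 0 (max (max C₁ C₂) (max C₃ C₄)), by simp, by simp, by simp, by simp, by simp⟩
  have hmove : ∀ a b x y, IsHamiltonianOn f a b x y → energy f xs (x a, y a) ≤ M →
      ∀ u ∈ Set.Icc a b, ‖x u - x a‖ ≤ C * (u - a) ∧ ‖y u - y a‖ ≤ C * (u - a) := by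
    intro a b x y hH hM u hu
    refine hH.norm_sub_le (fun v hv => ?_) hu
    have hv' : (x v, y v) ∈ {p | energy f xs p ≤ M} := (hH.energy_eq hf.differentiable hv).trans_le hM
    exact ⟨(h₃ _ hv').trans hC3, (h₄ _ hv').trans hC4⟩
  refine ⟨C, hC0, fun p hp => ⟨(h₁ p hp).trans hC1, (h₂ p hp).trans hC2⟩, hmove, ?_⟩
  intro ε hε
  obtain ⟨δ₁, hδ₁, hu₁⟩ := Metric.uniformContinuousOn_iff.1
    (hK.uniformContinuousOn_of_continuous hVc.continuousOn) ε hε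
  obtain ⟨δ₂, hδ₂, hu₂⟩ := Metric.uniformContinuousOn_iff.1
    (hK.uniformContinuousOn_of_continuous hDc.continuousOn) ε hε
  -- The factor 2 allows for a step split by an event: the position moves at most `C * h` on either
  -- side of it.
  obtain ⟨δ, hδ, hd1, hd2⟩ : ∃ δ > 0, 2 * C * δ < δ₁ ∧ 2 * C * δ < δ₂ := by
    refine ⟨min δ₁ δ₂ / (2 * C + 1), by positivity, ?_⟩
    have : 2 * C * (min δ₁ δ₂ / (2 * C + 1)) < min δ₁ δ₂ := by
      rw [mul_div_assoc', div_lt_iff₀ (by positivity)]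
      nlinarith [lt_min hδ₁ hδ₂]
    exact ⟨this.trans_le (min_le_left _ _), this.trans_le (min_le_right _ _)⟩
  refine ⟨δ, hδ, ?_, ?_⟩
  · intro a b x y hab hb hH hM
    have key : ∀ u ∈ Set.Icc a b,
        lyapunovDrift f xs l (x u, y u) ≤ lyapunovDrift f xs l (x a, y a) + ε := by
      intro u hu
      have hm := hmove a b x y hH hM u hu
      have h5 : C * (u - a) ≤ 2 * C * δ := by
        have : C * (u - a) ≤ C * δ := by gcongr; linarith [hu.2]
        nlinarith [mul_nonneg hC0 hδ.le]
      have h6 := hu₂ (x u, y u) ((hH.energy_eq hf.differentiable hu).trans_le hM) (x a, y a) hM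
        (by
          rw [Prod.dist_eq, max_lt_iff, dist_eq_norm, dist_eq_norm]
          exact ⟨by linarith, by linarith⟩)
      rw [Real.dist_eq] at h6
      linarith [(abs_lt.1 h6).2]
    choose! D hD hD' using fun (u : ℝ) (hu : u ∈ Set.Icc a b) =>
      hH.exists_hasDerivAt_lyapunov (xs := xs) hl.le hf hu
    have h7 := image_le_of_deriv_right_le_deriv_boundary
      (f := fun u => lyapunov f xs l (x u, y u)) (f' := D) (a := a) (b := b)
      (B := fun u => lyapunov f xs l (x a, y a)
            + (u - a) * (lyapunovDrift f xs l (x a, y a) + ε))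
      (B' := fun _ => lyapunovDrift f xs l (x a, y a) + ε)
      (fun u hu => (hD' u hu).continuousAt.continuousWithinAt)
      (fun u hu => (hD' u (Set.Ico_subset_Icc_self hu)).hasDerivWithinAt)
      (by simp) (by fun_prop)
      (fun u _ => by
        have := (((hasDerivAt_id u).sub_const a).mul_const
          (lyapunovDrift f xs l (x a, y a) + ε)).const_add (lyapunov f xs l (x a, y a))
        rw [one_mul] at this
        exact this.hasDerivWithinAt)
      (fun u hu => (hD u (Set.Ico_subset_Icc_self hu)).trans (key u (Set.Ico_subset_Icc_self hu)))
    exact h7 (Set.right_mem_Icc.2 hab)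
  · intro h p q h0 hh hp hq hpq1 hpq2
    have h5 : 2 * C * h ≤ 2 * C * δ := by gcongr
    have h6 := hu₁ p hp q hq (by
      rw [Prod.dist_eq, max_lt_iff, dist_eq_norm, dist_eq_norm]
      exact ⟨by linarith, by linarith⟩)
    rw [Real.dist_eq] at h6
    linarith [(abs_lt.1 h6).2]

end

/-! ### Paths with refreshment -/

/-- Induction along `[0, ∞)` over the intervals between successive events. -/
theorem induction_between_events {τ : ℕ → ℝ} (hmono : StrictMono τ)
    (htop : Tendsto τ atTop atTop) {Q : ℝ → Prop} (h0 : Q 0)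
    (hstep : ∀ a b, 0 ≤ a → a ≤ b → (∀ k, τ k ∉ Set.Ioo a b) → Q a → Q b) {t : ℝ} (ht : 0 ≤ t) :
    Q t := by
  have key : ∀ n, ∀ t, 0 ≤ t → t ≤ τ n → Q t := by
    intro n
    induction n with
    | zero =>
      intro t ht htn
      refine hstep 0 t le_rfl ht (fun k hk => ?_) h0
      exact absurd (hk.2.trans_le htn) (not_lt.2 (hmono.monotone (Nat.zero_le k)))
    | succ n ih =>
      intro t ht htn
      rcases le_or_gt t (τ n) with h | h
      · exact ih t ht h
      · refine hstep (max 0 (τ n)) t (le_max_left _ _) (max_le ht h.le) (fun k hk => ?_) ?_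
        · have h1 := hmono.lt_iff_lt.1 ((le_max_right 0 (τ n)).trans_lt hk.1)
          have h2 := hmono.lt_iff_lt.1 (hk.2.trans_le htn)
          omega
        · rcases le_total 0 (τ n) with h1 | h1
          · rw [max_eq_right h1]; exact ih _ h1 le_rfl
          · rw [max_eq_left h1]; exact h0
  obtain ⟨n, hn⟩ := (htop.eventually_ge_atTop t).exists
  exact key n t ht hn

theorem finite_setOf_event_le {τ : ℕ → ℝ} (htop : Tendsto τ atTop atTop) (t : ℝ) :
    {k | τ k ≤ t}.Finite := by
  obtain ⟨n, hn⟩ := eventually_atTop.1 (htop.eventually_gt_atTop t)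
  exact (Set.finite_lt_nat n).subset fun k hk => by
    by_contra h
    exact absurd (hn k (not_lt.1 h)) (not_lt.2 hk)

namespace IsRefreshedHamiltonianPath

variable {d : ℕ} {f : EuclideanSpace ℝ (Fin d) → ℝ} {τ : ℕ → ℝ}
  {x y : ℝ → EuclideanSpace ℝ (Fin d)} {xs : EuclideanSpace ℝ (Fin d)} {a b : ℝ}

theorem intervalIntegrable_gradient (hp : IsRefreshedHamiltonianPath f τ x y) (ha : 0 ≤ a)
    (hb : 0 ≤ b) : IntervalIntegrable (fun s => ∇ f (x s)) volume a b :=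
  (hp.integrable_gradient a ha).symm.trans (hp.integrable_gradient b hb)

theorem velocity_eq_of_no_event (hp : IsRefreshedHamiltonianPath f τ x y) (ha : 0 ≤ a)
    (hab : a ≤ b) (hev : ∀ k, τ k ∉ Set.Ioc a b) : y b = y a - ∫ s in a..b, ∇ f (x s) := by
  have hset : {k | τ k ≤ b} = {k | τ k ≤ a} := by
    ext k
    refine ⟨fun hk => ?_, fun hk => le_trans hk hab⟩
    by_contra h
    exact hev k ⟨not_le.1 h, hk⟩
  rw [hp.velocity_eq b (ha.trans hab), hp.velocity_eq a ha, hset,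
    ← intervalIntegral.integral_add_adjacent_intervals (hp.integrable_gradient a ha)
      (hp.intervalIntegrable_gradient ha (ha.trans hab))]
  abel

/-- Just before `τ k` the velocity equation sums over `j < k` only, so its limit from the left is
the value at `τ k` without the `k`-th term. That term subtracts this same left limit. -/
theorem velocity_event_eq_zero (hp : IsRefreshedHamiltonianPath f τ x y) (hmono : StrictMono τ)
    {k : ℕ} (hk : 0 < τ k) : y (τ k) = 0 := by
  have hint := hp.integrable_gradient (τ k) hk.le
  have hIic : {j | τ j ≤ τ k} = insert k (Set.Iio k) := by
    ext j
    rw [Set.Iio_insert]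
    exact hmono.le_iff_le
  have hev : ∀ᶠ u in 𝓝[<] τ k, {j | τ j ≤ u} = Set.Iio k := by
    have h1 : ∀ᶠ u in 𝓝[<] τ k, ∀ j ∈ Set.Iio k, τ j < u :=
      (Set.finite_Iio k).eventually_all.2 fun j hj =>
        mem_nhdsWithin_of_mem_nhds (lt_mem_nhds (hmono hj))
    filter_upwards [h1, self_mem_nhdsWithin] with u hu hu'
    ext j
    refine ⟨fun hj => ?_, fun hj => (hu j hj).le⟩
    exact hmono.lt_iff_lt.1 (lt_of_le_of_lt hj hu')
  have hprim : Tendsto (fun u => ∫ s in (0 : ℝ)..u, ∇ f (x s)) (𝓝[<] τ k)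
      (𝓝 (∫ s in (0 : ℝ)..τ k, ∇ f (x s))) := by
    have h1 := intervalIntegral.continuousOn_primitive_interval' hint Set.left_mem_uIcc
    rw [Set.uIcc_of_le hk.le] at h1
    refine (h1 (τ k) (Set.right_mem_Icc.2 hk.le)).mono_left ?_
    rw [← nhdsWithin_Ioo_eq_nhdsLT hk]
    exact nhdsWithin_mono _ Set.Ioo_subset_Icc_self
  have hlim : Tendsto y (𝓝[<] τ k) (𝓝 (y 0 - (∫ s in (0 : ℝ)..τ k, ∇ f (x s))
      - ∑ᶠ j ∈ Set.Iio k, Function.leftLim y (τ j))) := by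
    refine ((hprim.const_sub (y 0)).sub_const _).congr' ?_
    filter_upwards [hev, mem_nhdsWithin_of_mem_nhds (lt_mem_nhds hk)] with u hu hu0
    rw [hp.velocity_eq u hu0.le, hu]
  have hleft := leftLim_eq_of_tendsto hlim
  rw [hp.velocity_eq (τ k) hk.le, hIic,
    finsum_mem_insert _ (by simp) (Set.finite_Iio k), hleft]
  abel

/-- Integrability of `y` is not part of the path structure, and the integral in the position
equation can be split at intermediate times only once it is known. -/
theorem intervalIntegrable_velocity (hp : IsRefreshedHamiltonianPath f τ x y)
    (hmono : StrictMono τ) (htop : Tendsto τ atTop atTop) {t : ℝ} (ht : 0 ≤ t) :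
    IntervalIntegrable y volume 0 t := by
  refine induction_between_events hmono htop (Q := fun t => IntervalIntegrable y volume 0 t)
    (by simp) (fun a b ha hab hev hQ => hQ.trans ?_) ht
  have h1 : IntervalIntegrable (fun u => y a - ∫ s in a..u, ∇ f (x s)) volume a b :=
    (continuousOn_const.sub (intervalIntegral.continuousOn_primitive_interval'
      (hp.intervalIntegrable_gradient ha (ha.trans hab)) Set.left_mem_uIcc)).intervalIntegrable
  refine h1.congr_uIoo fun u hu => ?_
  rw [Set.uIoo_of_le hab] at hu
  exact (hp.velocity_eq_of_no_event ha hu.1.le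
    fun k hk => hev k ⟨hk.1, hk.2.trans_lt hu.2⟩).symm

theorem position_eq_add (hp : IsRefreshedHamiltonianPath f τ x y)
    (hmono : StrictMono τ) (htop : Tendsto τ atTop atTop) (ha : 0 ≤ a) (hab : a ≤ b) :
    x b = x a + ∫ s in a..b, y s := by
  have h1 := hp.intervalIntegrable_velocity hmono htop ha
  have h2 := hp.intervalIntegrable_velocity hmono htop (ha.trans hab)
  rw [hp.position_eq b (ha.trans hab), hp.position_eq a ha,
    ← intervalIntegral.integral_add_adjacent_intervals h1 (h1.symm.trans h2), add_assoc]

/-- Between events the path follows the Hamiltonian flow. -/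
theorem exists_isHamiltonianOn (hp : IsRefreshedHamiltonianPath f τ x y)
    (hf : Continuous (∇ f)) (hmono : StrictMono τ) (htop : Tendsto τ atTop atTop)
    (ha : 0 ≤ a) (hab : a ≤ b) (hev : ∀ k, τ k ∉ Set.Ioo a b) :
    ∃ x' y', IsHamiltonianOn f a b x' y' ∧ (∀ u ∈ Set.Icc a b, x' u = x u) ∧
      ∀ u ∈ Set.Icc a b, (∀ k, τ k ∉ Set.Ioc a u) → y' u = y u := by
  have hxc : ContinuousOn x (Set.Icc a b) := by
    have h1 := hp.intervalIntegrable_velocity hmono htop ha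
    have h2 := hp.intervalIntegrable_velocity hmono htop (ha.trans hab)
    have h3 := intervalIntegral.continuousOn_primitive_interval' (h1.symm.trans h2)
      Set.left_mem_uIcc
    rw [Set.uIcc_of_le hab] at h3
    exact (continuousOn_const.add h3).congr fun u hu => hp.position_eq_add hmono htop ha hu.1
  -- Extending the gradient constantly outside `[a, b]` gives two-sided derivatives at the
  -- endpoints. The resulting `y'` ignores a reset at `b`, so it may differ from `y` there, whereas
  -- the positions agree on all of `[a, b]`.
  set G : ℝ → EuclideanSpace ℝ (Fin d) :=
    Set.IccExtend hab ((Set.Icc a b).domRestrict fun s => ∇ f (x s)) with hG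
  have hGc : Continuous G := (hf.comp_continuousOn hxc).domRestrict.Icc_extend'
  have hGeq : ∀ u ∈ Set.Icc a b, G u = ∇ f (x u) := fun u hu => Set.IccExtend_of_mem hab _ hu
  set y' : ℝ → EuclideanSpace ℝ (Fin d) := fun u => y a - ∫ s in a..u, G s with hy'
  have hy'd : ∀ u, HasDerivAt y' (-G u) u := fun u =>
    (hGc.integral_hasStrictDerivAt a u).hasDerivAt.const_sub _
  have hy'c : Continuous y' := continuous_iff_continuousAt.2 fun u => (hy'd u).continuousAt
  have hy'eq : ∀ u ∈ Set.Icc a b, (∀ k, τ k ∉ Set.Ioc a u) → y' u = y u := by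
    intro u hu hk
    rw [hp.velocity_eq_of_no_event ha hu.1 hk]
    refine congrArg (y a - ·) ?_
    refine intervalIntegral.integral_congr fun s hs => hGeq s ?_
    rw [Set.uIcc_of_le hu.1] at hs
    exact ⟨hs.1, hs.2.trans hu.2⟩
  set x' : ℝ → EuclideanSpace ℝ (Fin d) := fun u => x a + ∫ s in a..u, y' s with hx'
  have hx'd : ∀ u, HasDerivAt x' (y' u) u := fun u =>
    (hy'c.integral_hasStrictDerivAt a u).hasDerivAt.const_add _
  have hx'eq : ∀ u ∈ Set.Icc a b, x' u = x u := by
    intro u hu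
    rw [hp.position_eq_add hmono htop ha hu.1]
    refine congrArg (x a + ·) ?_
    refine intervalIntegral.integral_congr_uIoo fun s hs => ?_
    rw [Set.uIoo_of_le hu.1] at hs
    exact hy'eq s ⟨hs.1.le, hs.2.le.trans hu.2⟩ fun k hk =>
      hev k ⟨hk.1, (hk.2.trans_lt hs.2).trans_le hu.2⟩
  refine ⟨x', y', fun u hu => ⟨hx'd u, ?_⟩, hx'eq, hy'eq⟩
  rw [hx'eq u hu, ← hGeq u hu]
  exact hy'd u

/-- Energy is conserved between events, and a reset at the right endpoint only removes kinetic
energy. -/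
theorem energy_le (hp : IsRefreshedHamiltonianPath f τ x y)
    (hfd : Differentiable ℝ f) (hf : Continuous (∇ f)) (hpos : 0 < τ 0) (hmono : StrictMono τ)
    (htop : Tendsto τ atTop atTop) {t : ℝ} (ht : 0 ≤ t) :
    energy f xs (x t, y t) ≤ energy f xs (x 0, y 0) := by
  refine induction_between_events hmono htop
    (Q := fun t => energy f xs (x t, y t) ≤ energy f xs (x 0, y 0)) le_rfl
    (fun a b ha hab hev hQ => le_trans ?_ hQ) ht
  obtain ⟨x', y', hH, hx, hy⟩ := hp.exists_isHamiltonianOn hf hmono htop ha hab hev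
  have hb := Set.right_mem_Icc.2 hab
  have h1 := hH.energy_eq (xs := xs) hfd hb
  have ha' := Set.left_mem_Icc.2 hab
  rw [hx b hb, hx a ha', hy a ha' (by simp)] at h1
  rw [← h1]
  by_cases h : ∀ k, τ k ∉ Set.Ioc a b
  · rw [hy b hb h]
  · push Not at h
    obtain ⟨k, hk⟩ := h
    have hkb : τ k = b := hk.2.antisymm (not_lt.1 fun h => hev k ⟨hk.1, h⟩)
    rw [← hkb, hp.velocity_event_eq_zero hmono (hpos.trans_le (hmono.monotone (Nat.zero_le k)))]
    exact energy_rest_le _ _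

end IsRefreshedHamiltonianPath

/-- One-step estimates for the Lyapunov function along a refreshed Hamiltonian path, according to
whether there is no event or one event during the step. -/
theorem exists_refreshed_step_estimates {d : ℕ} {f : EuclideanSpace ℝ (Fin d) → ℝ}
    {xs : EuclideanSpace ℝ (Fin d)} {l : ℝ} (hl : 0 < l) (hf : IsStronglyConvex (5 * l ^ 2) f)
    (hxs : ∀ x, f xs ≤ f x) (M : ℝ) :
    ∃ C : ℝ, 0 ≤ C ∧
      (∀ p, energy f xs p ≤ M → |lyapunov f xs l p| ≤ C ∧ |lyapunovDrift f xs l p| ≤ C) ∧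
      ∀ ε > 0, ∃ δ > 0, ∀ τ x y, IsRefreshedHamiltonianPath f τ x y → 0 < τ 0 → StrictMono τ →
        Tendsto τ atTop atTop → energy f xs (x 0, y 0) ≤ M → ∀ t h, 0 ≤ t → 0 ≤ h → h ≤ δ →
        ((∀ k, τ k ∉ Set.Ioc t (t + h)) →
          lyapunov f xs l (x (t + h), y (t + h)) ≤ lyapunov f xs l (x t, y t)
            + h * (lyapunovDrift f xs l (x t, y t) + ε)) ∧
        ((∃! k, τ k ∈ Set.Ioc t (t + h)) →
          lyapunov f xs l (x (t + h), y (t + h)) ≤ lyapunov f xs l (x t, 0) + ε) := by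
  obtain ⟨C, hC0, hbound, hmove, hstep⟩ := exists_step_estimates hl hf hxs M
  refine ⟨C, hC0, hbound, fun ε hε => ?_⟩
  obtain ⟨δ, hδ, hflow, hnear⟩ := hstep ε hε
  refine ⟨δ, hδ, ?_⟩
  intro τ x y hp hpos hmono htop hM t h ht hh hhδ
  have hg := hf.continuous_gradient (by positivity)
  have hEM : ∀ s, 0 ≤ s → energy f xs (x s, y s) ≤ M := fun s hs =>
    (hp.energy_le hf.differentiable hg hpos hmono htop hs).trans hM
  have hth : t ≤ t + h := by linarith
  constructor
  · intro hev
    obtain ⟨x', y', hH, hx, hy⟩ := hp.exists_isHamiltonianOn hg hmono htop ht hth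
      (fun k hk => hev k (Set.Ioo_subset_Ioc_self hk))
    have hl' := Set.left_mem_Icc.2 hth
    have hr' := Set.right_mem_Icc.2 hth
    have h1 := hflow t (t + h) x' y' hth (by linarith) hH
      (by rw [hx t hl', hy t hl' (by simp)]; exact hEM t ht)
    rw [hx t hl', hy t hl' (by simp), hx _ hr', hy _ hr' hev] at h1
    simpa using h1
  · rintro ⟨k, hk, huniq⟩
    set s := τ k with hs
    have hys : y s = 0 :=
      hp.velocity_event_eq_zero hmono (hpos.trans_le (hmono.monotone (Nat.zero_le k)))
    have hs0 : 0 ≤ s := ht.trans hk.1.le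
    have hev : ∀ j, τ j ∈ Set.Ioc t (t + h) → τ j = s := fun j hj => by rw [huniq j hj]
    obtain ⟨x₁, y₁, hH₁, hx₁, hy₁⟩ := hp.exists_isHamiltonianOn hg hmono htop ht hk.1.le
      (fun j hj => hj.2.ne (hev j ⟨hj.1, hj.2.le.trans hk.2⟩))
    have hev₂ : ∀ j, τ j ∉ Set.Ioc s (t + h) := fun j hj =>
      hj.1.ne' (hev j ⟨hk.1.trans hj.1, hj.2⟩)
    obtain ⟨x₂, y₂, hH₂, hx₂, hy₂⟩ := hp.exists_isHamiltonianOn hg hmono htop hs0 hk.2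
      (fun j hj => hev₂ j (Set.Ioo_subset_Ioc_self hj))
    have l₁ := Set.left_mem_Icc.2 hk.1.le
    have r₁ := Set.right_mem_Icc.2 hk.1.le
    have l₂ := Set.left_mem_Icc.2 hk.2
    have r₂ := Set.right_mem_Icc.2 hk.2
    have m₁ := (hmove t s x₁ y₁ hH₁
      (by rw [hx₁ t l₁, hy₁ t l₁ (by simp)]; exact hEM t ht) s r₁).1
    have m₂ := hmove s (t + h) x₂ y₂ hH₂
      (by rw [hx₂ s l₂, hy₂ s l₂ (by simp)]; exact hEM s hs0) (t + h) r₂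
    rw [hx₁ _ l₁, hx₁ _ r₁] at m₁
    rw [hx₂ _ l₂, hx₂ _ r₂, hy₂ _ l₂ (by simp), hy₂ _ r₂ hev₂, hys] at m₂
    have e₁ : C * (s - t) ≤ C * h := by gcongr; linarith [hk.2]
    have e₂ : C * (t + h - s) ≤ C * h := by gcongr; linarith [hk.1]
    -- The velocity restarts from `0` at `s`, so the final state is close to `(x t, 0)`, whatever
    -- the velocity was before the event.
    refine hnear h _ _ hh hhδ (hEM _ (ht.trans hth))
      ((energy_rest_le _ (y t)).trans (hEM t ht)) ?_ ?_
    · calc ‖x (t + h) - x t‖ = ‖(x (t + h) - x s) + (x s - x t)‖ := by congr 1; abel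
        _ ≤ _ := norm_add_le _ _
        _ ≤ _ := by linarith [m₂.1]
    · have : 0 ≤ C * h := by positivity
      exact m₂.2.trans (by linarith)

/-! ### Discrete Grönwall inequality and Poisson weights -/

/-- A nonnegative function whose one-step growth is at most `(1 - l h) φ t + o(h)`, uniformly in
`t`, decays exponentially with rate `l`. -/
theorem le_exp_mul_of_step_le {φ : ℝ → ℝ} {l : ℝ} (hl : 0 ≤ l) (h0 : 0 ≤ φ 0)
    (hstep : ∀ η > 0, ∃ δ > 0, ∀ t h, 0 ≤ t → 0 ≤ h → h ≤ δ →
      φ (t + h) ≤ (1 - l * h) * φ t + η * h) {t : ℝ} (ht : 0 ≤ t) :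
    φ t ≤ Real.exp (-l * t) * φ 0 := by
  refine le_of_forall_pos_le_add fun ε hε => ?_
  -- The errors of the `n` steps add up to at most `t * (ε / (t + 1)) ≤ ε`. The choice of `n` makes
  -- the step `t / n` at most `δ` and keeps `1 - l * h` nonnegative.
  obtain ⟨δ, hδ, hs⟩ := hstep (ε / (t + 1)) (by positivity)
  obtain ⟨n, hn⟩ := exists_nat_gt (t / δ + l * t)
  have hn0 : (0 : ℝ) < n := lt_of_le_of_lt (by positivity) hn
  have hdiv : 0 ≤ t / δ := by positivity
  have hlt : 0 ≤ l * t := by positivity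
  set h := t / n with hh
  have hh0 : 0 ≤ h := by positivity
  have hnh : n * h = t := by rw [hh]; field_simp
  have hhδ : h ≤ δ := by
    rw [hh, div_le_iff₀ hn0, mul_comm, ← div_le_iff₀ hδ]
    linarith
  have hlh : 0 ≤ 1 - l * h := by
    rw [hh, mul_div_assoc', sub_nonneg, div_le_one hn0]
    linarith
  have hlh' : 1 - l * h ≤ 1 := by
    have : 0 ≤ l * h := by positivity
    linarith
  have key : ∀ k : ℕ, φ (k * h) ≤ (1 - l * h) ^ k * φ 0 + k * (ε / (t + 1) * h) := by
    intro k
    induction k with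
    | zero => simp
    | succ k ih =>
      have h1 := hs (k * h) h (by positivity) hh0 hhδ
      have h2 := mul_le_mul_of_nonneg_left ih hlh
      have h3 : (1 - l * h) * (k * (ε / (t + 1) * h)) ≤ 1 * (k * (ε / (t + 1) * h)) :=
        mul_le_mul_of_nonneg_right hlh' (by positivity)
      push_cast
      rw [add_mul, one_mul, pow_succ]
      linarith
  have h1 := key n
  rw [hnh] at h1
  have h2 : (1 - l * h) ^ n ≤ Real.exp (-l * t) := by
    rw [← hnh, show -l * (n * h) = n * (-(l * h)) by ring, Real.exp_nat_mul]
    exact pow_le_pow_left₀ hlh (Real.one_sub_le_exp_neg _) n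
  have h3 : (n : ℝ) * (ε / (t + 1) * h) ≤ ε := by
    rw [show (n : ℝ) * (ε / (t + 1) * h) = ε * t / (t + 1) by rw [← hnh]; ring,
      div_le_iff₀ (by positivity)]
    nlinarith
  have h4 := mul_le_mul_of_nonneg_right h2 h0
  linarith

theorem Real.exp_neg_le_one_sub_add_sq {r : ℝ} (hr : 0 ≤ r) : Real.exp (-r) ≤ 1 - r + r ^ 2 := by
  have h1 : 1 ≤ (1 - r + r ^ 2) * (1 + r) := by nlinarith [pow_nonneg hr 3]
  have h2 : (1 - r + r ^ 2) * (1 + r) ≤ (1 - r + r ^ 2) * Real.exp r :=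
    mul_le_mul_of_nonneg_left (by linarith [Real.add_one_le_exp r]) (by nlinarith [sq_nonneg (r - 1)])
  rw [Real.exp_neg, inv_le_iff_one_le_mul₀ (Real.exp_pos r)]
  linarith

/-- Here `v`, `d`, `w` stand for the means of `V`, of its drift and of `V` after a reset. Replacing
the probabilities of zero, one and more events by `1 - g h`, `g h` and `0` costs at most `(3 g² + g)
C h²`; what remains to first order is `v + h (d + g (w - v))`. -/
theorem poisson_step_arith {l g h v d w C ε : ℝ} (hg : 0 ≤ g) (hh : 0 ≤ h) (hε : 0 ≤ ε)
    (hv : |v| ≤ C) (hd : |d| ≤ C) (hw : |w| ≤ C) (hdrift : d + g * (w - v) ≤ -l * v) :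
    Real.exp (-(g * h)) * (v + h * (d + ε)) + Real.exp (-(g * h)) * (g * h) * (w + ε)
        + (1 - Real.exp (-(g * h)) - Real.exp (-(g * h)) * (g * h)) * C
      ≤ (1 - l * h) * v + h * ((1 + g) * ε + (3 * g ^ 2 + g) * C * h) := by
  have hr : 0 ≤ g * h := by positivity
  have hC : 0 ≤ C := (abs_nonneg v).trans hv
  have e1 := Real.exp_neg_le_one_sub_add_sq hr
  have e2 := Real.one_sub_le_exp_neg (g * h)
  have e3 : Real.exp (-(g * h)) ≤ 1 := Real.exp_le_one_iff.2 (by linarith)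
  set r := g * h with hrdef
  set e := Real.exp (-r)
  have a1 : (e - 1 + r) * v ≤ r ^ 2 * C := by
    calc (e - 1 + r) * v ≤ (e - 1 + r) * C :=
          mul_le_mul_of_nonneg_left (abs_le.1 hv).2 (by linarith)
      _ ≤ _ := mul_le_mul_of_nonneg_right (by linarith) hC
  have a2 : (1 - e) * (h * -d) ≤ r * (h * C) := by
    calc (1 - e) * (h * -d) ≤ (1 - e) * (h * C) := by
          refine mul_le_mul_of_nonneg_left (mul_le_mul_of_nonneg_left ?_ hh) (by linarith)
          linarith [(abs_le.1 hd).1]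
      _ ≤ _ := mul_le_mul_of_nonneg_right (by linarith) (by positivity)
  have a3 : (1 - e) * (r * -w) ≤ r * (r * C) := by
    calc (1 - e) * (r * -w) ≤ (1 - e) * (r * C) := by
          refine mul_le_mul_of_nonneg_left (mul_le_mul_of_nonneg_left ?_ hr) (by linarith)
          linarith [(abs_le.1 hw).1]
      _ ≤ _ := mul_le_mul_of_nonneg_right (by linarith) (by positivity)
  have a4 : (1 - e - e * r) * C ≤ r ^ 2 * C := by
    refine mul_le_mul_of_nonneg_right ?_ hC
    nlinarith [mul_le_mul_of_nonneg_right e2 (show 0 ≤ 1 + r by linarith)]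
  have a5 : e * (h * ε) ≤ 1 * (h * ε) := mul_le_mul_of_nonneg_right e3 (by positivity)
  have a6 : e * (r * ε) ≤ 1 * (r * ε) := mul_le_mul_of_nonneg_right e3 (by positivity)
  have a7 := mul_le_mul_of_nonneg_left hdrift hh
  calc _ = (e - 1 + r) * v + (1 - e) * (h * -d) + (1 - e) * (r * -w) + (1 - e - e * r) * C
        + e * (h * ε) + e * (r * ε) + (v + h * d + r * w - r * v) := by ring
    _ ≤ r ^ 2 * C + r * (h * C) + r * (r * C) + r ^ 2 * C + 1 * (h * ε) + 1 * (r * ε)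
        + (v + h * (-l * v)) := by
      have : h * d + r * w - r * v = h * (d + g * (w - v)) := by rw [hrdef]; ring
      linarith
    _ = _ := by rw [hrdef]; ring

/-! ### Integration over an independent count -/

section

variable {Ω : Type*} {mΩ : MeasurableSpace Ω} {P : Measure Ω} [IsProbabilityMeasure P]

theorem setIntegral_of_indep {m₁ m₂ : MeasurableSpace Ω} (h₁ : m₁ ≤ mΩ) (h₂ : m₂ ≤ mΩ)
    (hindep : Indep m₁ m₂ P) {S : Set Ω} (hS : MeasurableSet[m₁] S) {F : Ω → ℝ}
    (hF : Measurable[m₂] F) (hFi : Integrable F P) :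
    ∫ ω in S, F ω ∂P = P.real S * ∫ ω, F ω ∂P := by
  rw [← setIntegral_condExp h₁ hFi hS,
    setIntegral_congr_ae (h₁ S hS) ((condExp_indep_eq h₂ h₁ hF.stronglyMeasurable
      hindep.symm).mono fun ω h _ => h)]
  simp

/-- Integral bound by cases on the value of an independent counting variable. -/
theorem integral_le_of_count_cases {N : Ω → ℕ} (hN : Measurable N) {m : MeasurableSpace Ω}
    (hm : m ≤ mΩ) (hindep : Indep (MeasurableSpace.comap N ⊤) m P) {G F₀ F₁ : Ω → ℝ} {C : ℝ}
    (hG : Integrable G P) (hF₀ : Measurable[m] F₀) (hF₁ : Measurable[m] F₁)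
    (hi₀ : Integrable F₀ P) (hi₁ : Integrable F₁ P)
    (hle : ∀ᵐ ω ∂P, (N ω = 0 → G ω ≤ F₀ ω) ∧ (N ω = 1 → G ω ≤ F₁ ω) ∧ G ω ≤ C) :
    ∫ ω, G ω ∂P ≤ P.real (N ⁻¹' {0}) * ∫ ω, F₀ ω ∂P + P.real (N ⁻¹' {1}) * ∫ ω, F₁ ω ∂P
      + (1 - P.real (N ⁻¹' {0}) - P.real (N ⁻¹' {1})) * C := by
  have hN' : MeasurableSpace.comap N ⊤ ≤ mΩ := hN.comap_le
  have hS : ∀ i, MeasurableSet[MeasurableSpace.comap N ⊤] (N ⁻¹' {i}) := fun i => ⟨{i}, trivial, rfl⟩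
  have hS' := fun i => hN' _ (hS i)
  rw [← setIntegral_of_indep hN' hm hindep (hS 0) hF₀ hi₀,
    ← setIntegral_of_indep hN' hm hindep (hS 1) hF₁ hi₁,
    ← integral_add_compl (hS' 0) hG,
    ← integral_inter_add_sdiff (s := (N ⁻¹' {0})ᶜ) (hS' 1) hG.integrableOn]
  have hinter : (N ⁻¹' {0})ᶜ ∩ N ⁻¹' {1} = N ⁻¹' {1} := by
    ext ω; simp +contextual
  have hmeas : P.real ((N ⁻¹' {0})ᶜ \ N ⁻¹' {1})
      = 1 - P.real (N ⁻¹' {0}) - P.real (N ⁻¹' {1}) := by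
    have h1 := measureReal_inter_add_sdiff (μ := P) (s := (N ⁻¹' {0})ᶜ) (hS' 1)
    rw [hinter, probReal_compl_eq_one_sub (hS' 0)] at h1
    linarith
  rw [hinter, ← add_assoc, ← hmeas]
  refine add_le_add (add_le_add ?_ ?_) ?_
  · exact setIntegral_mono_on_ae hG.integrableOn hi₀.integrableOn (hS' 0)
      (hle.mono fun ω h hω => h.1 hω)
  · exact setIntegral_mono_on_ae hG.integrableOn hi₁.integrableOn (hS' 1)
      (hle.mono fun ω h hω => h.2.1 hω)
  · rw [← smul_eq_mul, ← setIntegral_const]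
    exact setIntegral_mono_on_ae hG.integrableOn (integrable_const C).integrableOn
      ((hS' 0).compl.diff (hS' 1)) (hle.mono fun ω h _ => h.2.2)

end

/-! ### Counting events in an interval -/

section

variable {Ω : Type*} {T : ℕ → Ω → ℝ} {ω : Ω} {s t : ℝ}

/-- Divergence of the event times makes the counted sets finite, so neither `ncard` nor the
truncated subtraction takes a default value. -/
theorem eventCount_sub_eq (htop : Tendsto (fun k => T k ω) atTop atTop) (hst : s ≤ t) :
    eventCount T t ω - eventCount T s ω = {k | T k ω ∈ Set.Ioc s t}.ncard := by
  have hsub : {k | T k ω ≤ s} ⊆ {k | T k ω ≤ t} := fun k hk => le_trans hk hst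
  rw [eventCount, eventCount,
    ← Set.ncard_sdiff hsub (finite_setOf_event_le (τ := fun k => T k ω) htop s)]
  congr 1
  ext k
  simp [and_comm]

theorem no_event_of_eventCount_sub (htop : Tendsto (fun k => T k ω) atTop atTop) (hst : s ≤ t)
    (h : eventCount T t ω - eventCount T s ω = 0) (k : ℕ) : T k ω ∉ Set.Ioc s t := by
  rw [eventCount_sub_eq htop hst, Set.ncard_eq_zero
    ((finite_setOf_event_le (τ := fun k => T k ω) htop t).subset fun k hk => hk.2)] at h
  exact fun hk => (Set.ext_iff.1 h k).1 hk

theorem existsUnique_event_of_eventCount_sub (htop : Tendsto (fun k => T k ω) atTop atTop)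
    (hst : s ≤ t) (h : eventCount T t ω - eventCount T s ω = 1) :
    ∃! k, T k ω ∈ Set.Ioc s t := by
  rw [eventCount_sub_eq htop hst, Set.ncard_eq_one] at h
  obtain ⟨k, hk⟩ := h
  exact ⟨k, (Set.ext_iff.1 hk k).2 rfl, fun j hj => (Set.ext_iff.1 hk j).1 hj⟩

end

/-! ### Decay of the expected Lyapunov function -/

section

variable {d : ℕ} {Ω : Type*} {mΩ : MeasurableSpace Ω} {P : Measure Ω}
  {ℱ : Filtration ℝ mΩ} {f : EuclideanSpace ℝ (Fin d) → ℝ} {T : ℕ → Ω → ℝ}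
  {X Y : ℝ → Ω → EuclideanSpace ℝ (Fin d)} {xs : EuclideanSpace ℝ (Fin d)} {l g : ℝ}

theorem IsPoissonProcess.measureReal_increment (h : IsPoissonProcess P ℱ (fun _ => g) T)
    (hg : 0 ≤ g) {t u : ℝ} (ht : 0 ≤ t) (hu : 0 ≤ u) (i : ℕ) :
    P.real ((fun ω => eventCount T (t + u) ω - eventCount T t ω) ⁻¹' {i})
      = Real.exp (-(g * u)) * (g * u) ^ i / i.factorial := by
  have hmeas : Measurable fun ω => eventCount T (t + u) ω - eventCount T t ω :=
    ((h.adapted _ (by linarith)).mono (ℱ.le _) le_rfl).sub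
      ((h.adapted _ ht).mono (ℱ.le _) le_rfl)
  have h1 := h.map_increment t (t + u) ht (by linarith)
  rw [← map_measureReal_apply hmeas (measurableSet_singleton i), h1, poissonMeasure_real_singleton,
    intervalIntegral.integral_const, add_sub_cancel_left, smul_eq_mul, mul_comm u g,
    Real.coe_toNNReal _ (by positivity)]

theorem IsRandomizedHamiltonianFlow.measurable_state
    (h : IsRandomizedHamiltonianFlow P ℱ f (fun _ => g) T X Y) {t : ℝ} (ht : 0 ≤ t) :
    Measurable[ℱ t] fun ω => (X t ω, Y t ω) :=
  (h.adapted_position t ht).prodMk (h.adapted_velocity t ht)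

theorem IsRandomizedHamiltonianFlow.ae_energy_le
    (h : IsRandomizedHamiltonianFlow P ℱ f (fun _ => g) T X Y) (hfd : Differentiable ℝ f)
    (hfc : Continuous (∇ f)) :
    ∀ᵐ ω ∂P, ∀ t, 0 ≤ t → energy f xs (X t ω, Y t ω) ≤ energy f xs (X 0 ω, Y 0 ω) := by
  filter_upwards [h.path, h.poisson.pos, h.poisson.strictMono, h.poisson.tendsto_atTop]
    with ω hp hpos hmono htop t ht
  exact hp.energy_le hfd hfc hpos hmono htop ht

variable [IsProbabilityMeasure P]

/-- The truncating event depends on the initial state only, so it lies in every `ℱ t` and the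
truncated variables at time `t` remain independent of the next Poisson increment. Two or more events
have probability `O(u²)`, and there the uniform bound `C` suffices. -/
theorem IsRandomizedHamiltonianFlow.exists_integral_lyapunov_step_le
    (h : IsRandomizedHamiltonianFlow P ℱ f (fun _ => 4 * l) T X Y) (hl : 0 < l)
    (hf : IsStronglyConvex (5 * l ^ 2) f) (hxs : ∀ x, f xs ≤ f x) (M : ℝ) :
    ∀ η > 0, ∃ δ > 0, ∀ t u, 0 ≤ t → 0 ≤ u → u ≤ δ →
      ∫ ω, {ω | energy f xs (X 0 ω, Y 0 ω) ≤ M}.indicator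
          (fun ω => lyapunov f xs l (X (t + u) ω, Y (t + u) ω)) ω ∂P
        ≤ (1 - l * u) * ∫ ω, {ω | energy f xs (X 0 ω, Y 0 ω) ≤ M}.indicator
          (fun ω => lyapunov f xs l (X t ω, Y t ω)) ω ∂P + η * u := by
  intro η hη
  obtain ⟨C, hC0, hbound, hstep⟩ := exists_refreshed_step_estimates hl hf hxs M
  -- Of the `2 + 4 * l` shares, `1 + 4 * l` pay for the errors on zero and one event and the last
  -- one for the second-order term `K * u`.
  set ε := η / (2 + 4 * l) with hε
  have hε0 : 0 < ε := by positivity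
  obtain ⟨δ, hδ, hpath⟩ := hstep ε hε0
  set K := (3 * (4 * l) ^ 2 + 4 * l) * C with hK
  have hK0 : 0 ≤ K := by positivity
  refine ⟨min δ (ε / (K + 1)), by positivity, fun t u ht hu huδ => ?_⟩
  have htu : 0 ≤ t + u := by linarith
  have hfc := hf.differentiable.continuous
  have hgc := hf.continuous_gradient (by positivity)
  set A := {ω | energy f xs (X 0 ω, Y 0 ω) ≤ M} with hA
  have hA0 : MeasurableSet[ℱ 0] A :=
    ((continuous_energy hfc).measurable.comp (h.measurable_state le_rfl)) measurableSet_Iic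
  have hAm : ∀ s, 0 ≤ s → MeasurableSet[ℱ s] A := fun s hs => ℱ.mono hs _ hA0
  have hE : ∀ᵐ ω ∂P, ∀ s, 0 ≤ s → ω ∈ A → energy f xs (X s ω, Y s ω) ≤ M := by
    filter_upwards [h.ae_energy_le (xs := xs) hf.differentiable hgc] with ω hω s hs hωA
    exact (hω s hs).trans hωA
  have hobs : ∀ (q : EuclideanSpace ℝ (Fin d) × EuclideanSpace ℝ (Fin d) → ℝ), Continuous q →
      (∀ p, energy f xs p ≤ M → |q p| ≤ C) → ∀ s, 0 ≤ s →
      Measurable[ℱ s] (A.indicator fun ω => q (X s ω, Y s ω)) ∧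
      Integrable (A.indicator fun ω => q (X s ω, Y s ω)) P ∧
      (∀ᵐ ω ∂P, |A.indicator (fun ω => q (X s ω, Y s ω)) ω| ≤ C) ∧
      |∫ ω, A.indicator (fun ω => q (X s ω, Y s ω)) ω ∂P| ≤ C := by
    intro q hq hqC s hs
    have hm : Measurable[ℱ s] (A.indicator fun ω => q (X s ω, Y s ω)) :=
      (hq.measurable.comp (h.measurable_state hs)).indicator (hAm s hs)
    have hb : ∀ᵐ ω ∂P, |A.indicator (fun ω => q (X s ω, Y s ω)) ω| ≤ C := by
      filter_upwards [hE] with ω hω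
      by_cases hωA : ω ∈ A
      · rw [Set.indicator_of_mem hωA]
        exact hqC _ (hω s hs hωA)
      · rw [Set.indicator_of_notMem hωA, abs_zero]
        exact hC0
    refine ⟨hm, Integrable.of_bound (hm.mono (ℱ.le s) le_rfl).aestronglyMeasurable C hb, hb, ?_⟩
    have := norm_integral_le_of_norm_le_const (μ := P)
      (f := A.indicator fun ω => q (X s ω, Y s ω)) hb
    simpa using this
  have hVb : ∀ p, energy f xs p ≤ M → |lyapunov f xs l p| ≤ C := fun p hp => (hbound p hp).1
  have hDb : ∀ p, energy f xs p ≤ M → |lyapunovDrift f xs l p| ≤ C := fun p hp => (hbound p hp).2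
  have hWb : ∀ p : EuclideanSpace ℝ (Fin d) × EuclideanSpace ℝ (Fin d), energy f xs p ≤ M →
      |lyapunov f xs l (p.1, 0)| ≤ C := fun p hp =>
    hVb _ ((energy_rest_le p.1 p.2).trans hp)
  have hVc : Continuous (lyapunov f xs l) := continuous_lyapunov hfc
  obtain ⟨hVm, hVi, -, hVC⟩ := hobs _ hVc hVb t ht
  obtain ⟨hDm, hDi, -, hDC⟩ := hobs _ (continuous_lyapunovDrift hfc) hDb t ht
  obtain ⟨hWm, hWi, -, hWC⟩ := hobs (fun p => lyapunov f xs l (p.1, 0))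
    (hVc.comp (by fun_prop)) hWb t ht
  obtain ⟨-, hVi', hVb', -⟩ := hobs _ hVc hVb (t + u) htu
  set V := A.indicator fun ω => lyapunov f xs l (X t ω, Y t ω) with hVdef
  set D := A.indicator fun ω => lyapunovDrift f xs l (X t ω, Y t ω) with hDdef
  set W := A.indicator fun ω => lyapunov f xs l (X t ω, 0) with hWdef
  set V' := A.indicator fun ω => lyapunov f xs l (X (t + u) ω, Y (t + u) ω) with hVdef'
  have hNm : Measurable fun ω => eventCount T (t + u) ω - eventCount T t ω :=
    ((h.poisson.adapted _ htu).mono (ℱ.le _) le_rfl).sub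
      ((h.poisson.adapted _ ht).mono (ℱ.le _) le_rfl)
  have hcases := integral_le_of_count_cases hNm (ℱ.le t)
    (h.poisson.indep_increment t (t + u) ht (by linarith)) (G := V')
    (F₀ := fun ω => V ω + u * (D ω + ε)) (F₁ := fun ω => W ω + ε) (C := C) hVi'
    (hVm.add ((hDm.add_const ε).const_mul u)) (hWm.add_const ε)
    (hVi.add ((hDi.add (integrable_const ε)).const_mul u)) (hWi.add (integrable_const ε)) (by
      filter_upwards [h.path, h.poisson.pos, h.poisson.strictMono, h.poisson.tendsto_atTop, hVb']
        with ω hp hpos hmono htop hb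
      refine ⟨fun h0 => ?_, fun h1 => ?_, (abs_le.1 hb).2⟩
      all_goals
        by_cases hωA : ω ∈ A
        swap
        -- Off `A` every truncated variable vanishes and only the error terms remain.
        · simp only [hVdef, hVdef', hDdef, hWdef, Set.indicator_of_notMem hωA]
          positivity
        have hs := hpath _ _ _ hp hpos hmono htop hωA t u ht hu (huδ.trans (min_le_left _ _))
        simp only [hVdef, hVdef', hDdef, hWdef, Set.indicator_of_mem hωA]
      · exact hs.1 (no_event_of_eventCount_sub htop (by linarith) h0)
      · exact hs.2 (existsUnique_event_of_eventCount_sub htop (by linarith) h1))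
  have hI₀ : ∫ ω, (V ω + u * (D ω + ε)) ∂P = ∫ ω, V ω ∂P + u * (∫ ω, D ω ∂P + ε) := by
    have h1 : Integrable (fun ω => D ω + ε) P := hDi.add (integrable_const ε)
    rw [integral_add hVi (h1.const_mul u), integral_const_mul, integral_add hDi (integrable_const ε)]
    simp
  have hI₁ : ∫ ω, (W ω + ε) ∂P = ∫ ω, W ω ∂P + ε := by
    rw [integral_add hWi (integrable_const ε)]
    simp
  rw [h.poisson.measureReal_increment (by positivity) ht hu,
    h.poisson.measureReal_increment (by positivity) ht hu, hI₀, hI₁] at hcases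
  simp only [pow_zero, pow_one, Nat.factorial, Nat.cast_one, mul_one, div_one] at hcases
  have hdrift : ∫ ω, D ω ∂P + 4 * l * (∫ ω, W ω ∂P - ∫ ω, V ω ∂P) ≤ -l * ∫ ω, V ω ∂P := by
    have hi : Integrable (fun ω => 4 * l * (W ω - V ω)) P := (hWi.sub hVi).const_mul _
    rw [← integral_sub hWi hVi, ← integral_const_mul, ← integral_const_mul, ← integral_add hDi hi]
    refine integral_mono (hDi.add hi) (hVi.const_mul _) fun ω => ?_
    by_cases hωA : ω ∈ A
    · simp only [hVdef, hDdef, hWdef, Set.indicator_of_mem hωA]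
      exact lyapunovDrift_add_jump_le hl.le (X t ω, Y t ω)
    · simp [hVdef, hDdef, hWdef, Set.indicator_of_notMem hωA]
  have harith := poisson_step_arith (h := u) (by positivity) hu hε0.le hVC hDC hWC hdrift
  have hKu : K * u ≤ ε := by
    have h1 : u * (K + 1) ≤ ε := (le_div_iff₀ (by positivity)).1 (huδ.trans (min_le_right _ _))
    linarith
  have hfin : u * ((1 + 4 * l) * ε + K * u) ≤ η * u := by
    have h1 : (2 + 4 * l) * ε = η := by rw [hε]; field_simp
    have h2 : (1 + 4 * l) * ε + K * u ≤ η := by linarith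
    rw [mul_comm η]
    exact mul_le_mul_of_nonneg_left h2 hu
  linarith

theorem lyapunov_nonneg (hxs : ∀ x, f xs ≤ f x)
    (p : EuclideanSpace ℝ (Fin d) × EuclideanSpace ℝ (Fin d)) : 0 ≤ lyapunov f xs l p :=
  (sub_nonneg.2 (hxs p.1)).trans (le_lyapunov p)

/-- The events of initial energy at most `n` exhaust the space. On each of them all integrals are
finite, and monotone convergence then needs no moment assumption on the initial state. -/
theorem IsRandomizedHamiltonianFlow.lintegral_le
    (h : IsRandomizedHamiltonianFlow P ℱ f (fun _ => 4 * l) T X Y) (hl : 0 < l)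
    (hf : IsStronglyConvex (5 * l ^ 2) f) (hxs : ∀ x, f xs ≤ f x) {t : ℝ} (ht : 0 ≤ t) :
    ∫⁻ ω, ENNReal.ofReal (f (X t ω) - f xs) ∂P ≤ ENNReal.ofReal (Real.exp (-l * t)) *
      ∫⁻ ω, ENNReal.ofReal (lyapunov f xs l (X 0 ω, Y 0 ω)) ∂P := by
  have hfc := hf.differentiable.continuous
  have hgc := hf.continuous_gradient (by positivity)
  have hVc : Continuous (lyapunov f xs l) := continuous_lyapunov hfc
  set A : ℕ → Set Ω := fun n => {ω | energy f xs (X 0 ω, Y 0 ω) ≤ n} with hA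
  have hAmono : Monotone A := fun m n hmn ω hω =>
    le_trans (show energy f xs (X 0 ω, Y 0 ω) ≤ m from hω) (Nat.cast_le.2 hmn)
  have hAU : ⋃ n, A n = Set.univ := Set.eq_univ_of_forall fun ω =>
    Set.mem_iUnion.2 (exists_nat_ge (energy f xs (X 0 ω, Y 0 ω)))
  have hAm : ∀ n, MeasurableSet (A n) := fun n => ℱ.le 0 _
    (((continuous_energy hfc).measurable.comp (h.measurable_state le_rfl)) measurableSet_Iic)
  rw [← setLIntegral_univ (fun ω => ENNReal.ofReal (f (X t ω) - f xs)), ← hAU,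
    setLIntegral_iUnion_of_directed _ hAmono.directed_le]
  refine iSup_le fun n => ?_
  have hint : ∀ s, 0 ≤ s → Integrable (fun ω => lyapunov f xs l (X s ω, Y s ω))
      (P.restrict (A n)) := by
    intro s hs
    obtain ⟨C, -, hbound, -⟩ := exists_refreshed_step_estimates hl hf hxs (n : ℝ)
    refine Integrable.of_bound ((hVc.measurable.comp
      (h.measurable_state hs)).mono (ℱ.le s) le_rfl).aestronglyMeasurable C ?_
    rw [ae_restrict_iff' (hAm n)]
    filter_upwards [h.ae_energy_le (xs := xs) hf.differentiable hgc] with ω hω hωA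
    exact (hbound _ ((hω s hs).trans hωA)).1
  have hV : ∀ s, 0 ≤ s → ENNReal.ofReal (∫ ω in A n, lyapunov f xs l (X s ω, Y s ω) ∂P)
      = ∫⁻ ω in A n, ENNReal.ofReal (lyapunov f xs l (X s ω, Y s ω)) ∂P := fun s hs =>
    ofReal_integral_eq_lintegral_ofReal (hint s hs)
      (Eventually.of_forall fun ω => lyapunov_nonneg hxs _)
  have hdecay := le_exp_mul_of_step_le (l := l)
    (φ := fun s => ∫ ω, (A n).indicator (fun ω => lyapunov f xs l (X s ω, Y s ω)) ω ∂P) hl.le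
    (integral_nonneg fun ω => Set.indicator_nonneg (fun ω _ => lyapunov_nonneg hxs _) ω)
    (h.exists_integral_lyapunov_step_le hl hf hxs n) ht
  simp only [integral_indicator (hAm n)] at hdecay
  calc ∫⁻ ω in A n, ENNReal.ofReal (f (X t ω) - f xs) ∂P
      ≤ ∫⁻ ω in A n, ENNReal.ofReal (lyapunov f xs l (X t ω, Y t ω)) ∂P :=
        lintegral_mono fun ω => ENNReal.ofReal_le_ofReal (le_lyapunov (X t ω, Y t ω))
    _ = ENNReal.ofReal (∫ ω in A n, lyapunov f xs l (X t ω, Y t ω) ∂P) := (hV t ht).symm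
    _ ≤ ENNReal.ofReal (Real.exp (-l * t) * ∫ ω in A n, lyapunov f xs l (X 0 ω, Y 0 ω) ∂P) :=
        ENNReal.ofReal_le_ofReal hdecay
    _ = ENNReal.ofReal (Real.exp (-l * t)) *
          ∫⁻ ω in A n, ENNReal.ofReal (lyapunov f xs l (X 0 ω, Y 0 ω)) ∂P := by
        rw [ENNReal.ofReal_mul (Real.exp_pos _).le, hV 0 le_rfl]
    _ ≤ _ := by gcongr; exact Measure.restrict_le_self

end

/-! ### The convergence theorem -/

theorem theorem3p1 {d : ℕ} {Ω : Type*} {mΩ : MeasurableSpace Ω} (P : Measure Ω)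
    [IsProbabilityMeasure P] (ℱ : Filtration ℝ mΩ)
    (f : EuclideanSpace ℝ (Fin d) → ℝ) (α : ℝ) (hα : 0 < α) (hf : IsStronglyConvex α f)
    (xstar : EuclideanSpace ℝ (Fin d)) (hxstar : ∀ x, f xstar ≤ f x)
    (T : ℕ → Ω → ℝ) (X Y : ℝ → Ω → EuclideanSpace ℝ (Fin d))
    (hXY : IsRandomizedHamiltonianFlow P ℱ f (fun _ => √(16 * α / 5)) T X Y)
    (hY0 : ∀ᵐ ω ∂P, Y 0 ω = 0) (t : ℝ) (ht : 0 ≤ t) :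
    -- the inequality between expectations in `[0, ∞]` of the nonnegative random variables
    (∫⁻ ω, ENNReal.ofReal (f (X t ω) - f xstar) ∂P
        ≤ ENNReal.ofReal (Real.exp (-√(α / 5) * t)) *
          ∫⁻ ω, ENNReal.ofReal (f (X 0 ω) - f xstar + α / 10 * ‖X 0 ω - xstar‖ ^ 2) ∂P) ∧
    -- the same in terms of real expectations, whenever `f (X 0)` has finite expectation
    (Integrable (fun ω => f (X 0 ω)) P →
      Integrable (fun ω => f (X t ω) - f xstar) P ∧
      Integrable (fun ω => f (X 0 ω) - f xstar + α / 10 * ‖X 0 ω - xstar‖ ^ 2) P ∧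
      ∫ ω, (f (X t ω) - f xstar) ∂P
        ≤ Real.exp (-√(α / 5) * t) *
          ∫ ω, (f (X 0 ω) - f xstar + α / 10 * ‖X 0 ω - xstar‖ ^ 2) ∂P) := by
  have hl : 0 < √(α / 5) := by positivity
  have hl2 : √(α / 5) ^ 2 = α / 5 := Real.sq_sqrt (by positivity)
  have hrate : √(16 * α / 5) = 4 * √(α / 5) := by
    rw [show 16 * α / 5 = 4 ^ 2 * (α / 5) by ring, Real.sqrt_mul (by positivity),
      Real.sqrt_sq (by positivity)]
  have hf' : IsStronglyConvex (5 * √(α / 5) ^ 2) f := by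
    rwa [hl2, mul_div_cancel₀ α (by norm_num)]
  rw [hrate] at hXY
  have hV0 : ∀ᵐ ω ∂P, lyapunov f xstar √(α / 5) (X 0 ω, Y 0 ω)
      = f (X 0 ω) - f xstar + α / 10 * ‖X 0 ω - xstar‖ ^ 2 := by
    filter_upwards [hY0] with ω hω
    rw [lyapunov_eq, energy, hω, inner_zero_left, norm_zero, hl2]
    ring
  have hmain := hXY.lintegral_le hl hf' hxstar ht
  rw [lintegral_congr_ae (hV0.mono fun ω hω => congrArg ENNReal.ofReal hω)] at hmain
  refine ⟨hmain, fun hint => ?_⟩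
  have hfm := hf.differentiable.continuous.measurable
  have hXm : ∀ s, 0 ≤ s → Measurable (X s) := fun s hs =>
    (hXY.adapted_position s hs).mono (ℱ.le s) le_rfl
  have hnn : ∀ x, 0 ≤ f x - f xstar := fun x => sub_nonneg.2 (hxstar x)
  have hint0 : Integrable (fun ω => f (X 0 ω) - f xstar) P := hint.sub (integrable_const _)
  have hR : Integrable (fun ω => f (X 0 ω) - f xstar + α / 10 * ‖X 0 ω - xstar‖ ^ 2) P := by
    -- Quadratic growth gives `α / 10 * ‖X 0 - xstar‖ ^ 2 ≤ f (X 0) - f xstar`, so integrability of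
    -- `f (X 0)` controls the second term too.
    refine hint0.add (hint0.mono' ?_ (Eventually.of_forall fun ω => ?_))
    · exact ((((hXm 0 le_rfl).sub_const xstar).norm.pow_const 2).const_mul _).aestronglyMeasurable
    · rw [Real.norm_of_nonneg (by positivity)]
      have h1 := hf.sq_norm_le hxstar (X 0 ω)
      have h2 : 0 ≤ α * ‖X 0 ω - xstar‖ ^ 2 := by positivity
      linarith
  have hRnn : ∀ ω, 0 ≤ f (X 0 ω) - f xstar + α / 10 * ‖X 0 ω - xstar‖ ^ 2 := fun ω =>
    add_nonneg (hnn _) (by positivity)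
  rw [← ofReal_integral_eq_lintegral_ofReal hR (Eventually.of_forall hRnn),
    ← ENNReal.ofReal_mul (Real.exp_pos _).le] at hmain
  have hLm : AEStronglyMeasurable (fun ω => f (X t ω) - f xstar) P :=
    ((hfm.comp (hXm t ht)).sub_const _).aestronglyMeasurable
  have hL : Integrable (fun ω => f (X t ω) - f xstar) P :=
    (lintegral_ofReal_ne_top_iff_integrable hLm (Eventually.of_forall fun ω => hnn _)).1
      (ne_top_of_le_ne_top ENNReal.ofReal_ne_top hmain)
  refine ⟨hL, hR, ?_⟩
  rw [← ofReal_integral_eq_lintegral_ofReal hL (Eventually.of_forall fun ω => hnn _)] at hmain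
  exact (ENNReal.ofReal_le_ofReal_iff
    (mul_nonneg (Real.exp_pos _).le (integral_nonneg hRnn))).1 hmain
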